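/- Let $n\ge 0$ and let $\Delta=\{\zeta\in\mathbb C:|\zeta|<1\}$, with Poincaré distance $\rho(a,b)=\operatorname{artanh}\left|\frac{a-b}{1-\bar a b}\right|$. For a domain (nonempty connected open set) $G\subset\mathbb C^n$, the Kobayashi pseudodistance $k_G(z,w)$ of $z,w\in G$ is the infimum of $\sum_{i=0}^{m-1}\rho(a_i,b_i)$ over all $m\ge1$, all points $z=x_0,x_1,\dots,x_m=w$ of $G$, all holomorphic maps $f_0,\dots,f_{m-1}\colon\Delta\to G$ and all $a_i,b_i\in\Delta$ with $f_i(a_i)=x_i$ and $f_i(b_i)=x_{i+1}$ for $0\le i<m$. The domain $G$ is called Kobayashi hyperbolic if $k_G$ is a distance, that is, $k_G(z,w)>0$ for all $z\ne w$ in $G$. \textbf{Proposition (Generalized Cartan uniqueness theorem).} Let $G$ be a Kobayashi hyperbolic domain in $\mathbb C^n$ and let $p\in G$. If a holomorphic map $f\colon G\to G$ satisfies \begin{enumerate} \item $f(p)=p$, \item the differential $df_p$ is the identity map of $\mathbb C^n$, \end{enumerate} then $f(z)=z$ for every $z\in G$. -/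

import Mathlib

open Set
open scoped ENNReal

noncomputable section

/-- The Poincaré (hyperbolic) distance of the open unit disc, of constant curvature `-4`:
`ρ(a, b) = artanh (|a - b| / |1 - conj a * b|)`.  It is only used for `|a| < 1`, `|b| < 1`. -/
def poincareDist (a b : ℂ) : ℝ :=
  Real.artanh (‖a - b‖ / ‖1 - (starRingEnd ℂ) a * b‖)

variable {E : Type*} [NormedAddCommGroup E] [NormedSpace ℂ E]

/-- A chain of holomorphic discs in `G` from `z` to `w`: a number `m ≥ 1`, points
`z = x 0, x 1, …, x m = w`, holomorphic maps `f i : Δ → G` from the open unit disc and points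
`a i, b i ∈ Δ` with `f i (a i) = x i` and `f i (b i) = x (i + 1)`, for `0 ≤ i < m`.
(The values of the sequences `x`, `f`, `a`, `b` at the other indices are irrelevant.) -/
structure HolDiscChain (G : Set E) (z w : E) where
  m : ℕ
  m_pos : 0 < m
  x : ℕ → E
  f : ℕ → ℂ → E
  a : ℕ → ℂ
  b : ℕ → ℂ
  x_zero : x 0 = z
  x_last : x m = w
  holo : ∀ i < m, DifferentiableOn ℂ (f i) (Metric.ball 0 1)
  mapsTo : ∀ i < m, MapsTo (f i) (Metric.ball 0 1) G
  a_mem : ∀ i < m, a i ∈ Metric.ball (0 : ℂ) 1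
  b_mem : ∀ i < m, b i ∈ Metric.ball (0 : ℂ) 1
  f_a : ∀ i < m, f i (a i) = x i
  f_b : ∀ i < m, f i (b i) = x (i + 1)

/-- The length of a chain of holomorphic discs: the sum of the Poincaré distances
`ρ(a i, b i)`. -/
def HolDiscChain.length {G : Set E} {z w : E} (c : HolDiscChain G z w) : ℝ :=
  ∑ i ∈ Finset.range c.m, poincareDist (c.a i) (c.b i)

/-- The Kobayashi pseudodistance of `G`: the infimum of the lengths of the chains of holomorphic
discs in `G` from `z` to `w`.  (It takes values in `[0, ∞]`, and is `∞` if there is no such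
chain, which does not happen for two points of a connected open set.) -/
def kobayashiEDist (G : Set E) (z w : E) : ℝ≥0∞ :=
  ⨅ c : HolDiscChain G z w, ENNReal.ofReal c.length

/-- `G` is Kobayashi hyperbolic: the Kobayashi pseudodistance of `G` is a distance, that is,
it separates the points of `G`. -/
def IsKobayashiHyperbolic (G : Set E) : Prop :=
  ∀ z ∈ G, ∀ w ∈ G, z ≠ w → 0 < kobayashiEDist G z w

end

/-!
# Cartan's uniqueness theorem for Kobayashi hyperbolic domains

Hyperbolicity enters only through a uniform bound on the iterates of `f` near `p`. The sphere
`‖w - p‖ = ε` is compact, and the Kobayashi pseudodistance from `p` is positive on it and locally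
bounded away from zero, so all chains from `p` to the sphere have length at least some `δ > 0`. A
chain of length less than `δ` starting at `p` then ends in the `ε`-ball, because a chain that leaves
the ball can be cut, without increasing its length, at a point where it crosses the sphere
(`HolDiscChain.mem_ball_of_length_lt`). Points near `p` are joined to `p` by such short chains, and
composing them with `f^[j]`, which fixes `p`, gives chains of the same length; hence all `f^[j]` map
a fixed ball around `p` into the `ε`-ball (`IsKobayashiHyperbolic.exists_mapsTo_ball_iterate`).

Now let `h = f - id`. Since `f` is strictly differentiable at `p` with derivative the identity,
`f^[j] - id = j • h + o(h)`. If `h = o(‖y - p‖ ^ n)`, then so is `f^[j] - id`, and the Schwarz lemma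
of order `n + 1` bounds it by `M * ‖y - p‖ ^ (n + 1)` with `M` independent of `j`. Dividing by `j`
and letting `j` grow shows `h = o(‖y - p‖ ^ (n + 1))`. So `h` vanishes to infinite order at `p`, and
the Schwarz lemma, now with growing order, gives `h = 0` near `p`
(`eqOn_id_of_forall_iterate_bounded`). The same consequence of the Schwarz lemma yields the identity
theorem that extends this to the connected set `G`
(`eqOn_zero_of_isPreconnected_of_eventuallyEq_zero`).
-/

open Filter Metric
open scoped Topology

variable {E F : Type*} [NormedAddCommGroup E] [NormedSpace ℂ E]
  [NormedAddCommGroup F] [NormedSpace ℂ F]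

/-! ### Discs and the Poincaré distance -/

theorem poincareDist_nonneg (a b : ℂ) : 0 ≤ poincareDist a b :=
  Real.artanh_nonneg (by positivity)

theorem poincareDist_zero_left (b : ℂ) : poincareDist 0 b = Real.artanh ‖b‖ := by
  simp [poincareDist]

theorem one_sub_conj_mul_ne_zero {a z : ℂ} (ha : ‖a‖ < 1) (hz : ‖z‖ < 1) :
    1 - (starRingEnd ℂ) a * z ≠ 0 := by
  intro h
  have h1 : ‖(starRingEnd ℂ) a * z‖ = 1 := by rw [← sub_eq_zero.mp h, norm_one]
  rw [norm_mul, RCLike.norm_conj] at h1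
  nlinarith [norm_nonneg a, norm_nonneg z]

theorem norm_sub_div_one_sub_conj_mul_lt_one {a z : ℂ} (ha : ‖a‖ < 1) (hz : ‖z‖ < 1) :
    ‖(a - z) / (1 - (starRingEnd ℂ) a * z)‖ < 1 := by
  rw [norm_div, div_lt_one (norm_pos_iff.mpr (one_sub_conj_mul_ne_zero ha hz)),
    ← sq_lt_sq₀ (norm_nonneg _) (norm_nonneg _)]
  have key : ‖1 - (starRingEnd ℂ) a * z‖ ^ 2 - ‖a - z‖ ^ 2 = (1 - ‖a‖ ^ 2) * (1 - ‖z‖ ^ 2) := by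
    simp only [Complex.sq_norm, Complex.normSq_apply, Complex.sub_re, Complex.sub_im,
      Complex.mul_re, Complex.mul_im, Complex.conj_re, Complex.conj_im, Complex.one_re,
      Complex.one_im]
    ring
  have h1 : 0 < 1 - ‖a‖ ^ 2 := by nlinarith [norm_nonneg a]
  have h2 : 0 < 1 - ‖z‖ ^ 2 := by nlinarith [norm_nonneg z]
  nlinarith [mul_pos h1 h2]

/-- Closed Poincaré discs are connected, being images of Euclidean discs under the involution
`ζ ↦ (a - ζ) / (1 - conj a * ζ)`. -/
theorem exists_isPreconnected_poincareDist_le {a b : ℂ} (ha : ‖a‖ < 1) (hb : ‖b‖ < 1) :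
    ∃ D ⊆ ball (0 : ℂ) 1, IsPreconnected D ∧ a ∈ D ∧ b ∈ D ∧
      ∀ c ∈ D, poincareDist a c ≤ poincareDist a b := by
  set φ : ℂ → ℂ := fun ζ => (a - ζ) / (1 - (starRingEnd ℂ) a * ζ) with hφ
  have hlt : ∀ ζ, ‖ζ‖ < 1 → ‖φ ζ‖ < 1 := fun ζ => norm_sub_div_one_sub_conj_mul_lt_one ha
  have hinv : ∀ ζ, ‖ζ‖ < 1 → φ (φ ζ) = ζ := by
    intro ζ hζ
    have h1 := one_sub_conj_mul_ne_zero ha hζ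
    have h2 := one_sub_conj_mul_ne_zero ha (hlt ζ hζ)
    have h3 := one_sub_conj_mul_ne_zero ha ha
    have e : 1 - (starRingEnd ℂ) a * φ ζ
        = (1 - (starRingEnd ℂ) a * a) / (1 - (starRingEnd ℂ) a * ζ) := by
      rw [eq_div_iff h1, sub_mul, mul_assoc, hφ, div_mul_cancel₀ _ h1]; ring
    change (a - φ ζ) / _ = ζ
    rw [div_eq_iff h2, e, mul_div_assoc', eq_div_iff h1, sub_mul]
    rw [hφ, div_mul_cancel₀ _ h1]; ring
  have hρ : ∀ ζ, poincareDist a ζ = Real.artanh ‖φ ζ‖ := fun ζ => by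
    rw [hφ, norm_div]; rfl
  have hball : ∀ ζ ∈ closedBall (0 : ℂ) ‖φ b‖, ‖ζ‖ < 1 := fun ζ hζ =>
    (mem_closedBall_zero_iff.mp hζ).trans_lt (hlt b hb)
  refine ⟨φ '' closedBall 0 ‖φ b‖, ?_, ?_, ⟨0, by simp, by simp [hφ]⟩,
    ⟨φ b, by simp, hinv b hb⟩, ?_⟩
  · rintro _ ⟨ζ, hζ, rfl⟩
    exact mem_ball_zero_iff.mpr (hlt ζ (hball ζ hζ))
  · refine (convex_closedBall (0 : ℂ) _).isPreconnected.image φ (ContinuousOn.div ?_ ?_ ?_)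
    · fun_prop
    · fun_prop
    · exact fun ζ hζ => one_sub_conj_mul_ne_zero ha (hball ζ hζ)
  · rintro _ ⟨ζ, hζ, rfl⟩
    rw [hρ, hρ, hinv ζ (hball ζ hζ)]
    exact Real.artanh_le_artanh (by linarith [norm_nonneg ζ]) (hlt b hb)
      (mem_closedBall_zero_iff.mp hζ)

theorem Real.tanh_pos_of_pos {x : ℝ} (hx : 0 < x) : 0 < Real.tanh x := by
  rw [Real.tanh_eq_sinh_div_cosh]
  exact div_pos (Real.sinh_pos_iff.mpr hx) (Real.cosh_pos x)

/-- Two points that are close relative to the distance to the complement of `G` lie on an affine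
disc in `G`, at a prescribed small Poincaré distance. -/
theorem exists_disc_of_norm_lt {G : Set E} {z w : E} {R η : ℝ} (hG : ball z R ⊆ G) (hη : 0 < η)
    (hzw : ‖w - z‖ < R * Real.tanh η) :
    ∃ (g : ℂ → E) (s : ℂ), DifferentiableOn ℂ g (ball 0 1) ∧ MapsTo g (ball 0 1) G ∧
      s ∈ ball (0 : ℂ) 1 ∧ g 0 = z ∧ g s = w ∧ poincareDist 0 s = η := by
  have hs : 0 < Real.tanh η := Real.tanh_pos_of_pos hη
  have hsc : ((Real.tanh η : ℝ) : ℂ) ≠ 0 := by exact_mod_cast hs.ne'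
  have hnorm : ‖((Real.tanh η : ℝ) : ℂ)‖ = Real.tanh η := by
    rw [Complex.norm_real, Real.norm_of_nonneg hs.le]
  refine ⟨fun ζ => z + (ζ / (Real.tanh η : ℝ)) • (w - z), (Real.tanh η : ℝ), ?_, ?_, ?_, ?_, ?_, ?_⟩
  · fun_prop
  · intro ζ hζ
    apply hG
    rw [mem_ball_zero_iff] at hζ
    rw [mem_ball_iff_norm, add_sub_cancel_left, norm_smul, norm_div, hnorm]
    calc ‖ζ‖ / Real.tanh η * ‖w - z‖ ≤ 1 / Real.tanh η * ‖w - z‖ := by gcongr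
      _ < 1 / Real.tanh η * (R * Real.tanh η) := by gcongr
      _ = R := by field_simp
  · rw [mem_ball_zero_iff, hnorm]; exact Real.tanh_lt_one η
  · simp
  · change z + (((Real.tanh η : ℝ) : ℂ) / (Real.tanh η : ℝ)) • (w - z) = w
    rw [div_self hsc, one_smul, add_sub_cancel]
  · rw [poincareDist_zero_left, hnorm, Real.artanh_tanh]

/-! ### Chains of discs -/

namespace HolDiscChain

variable {G : Set E} {z w : E}

/-- The first `k` discs of a chain, followed by one more disc, form a chain. -/
theorem exists_truncate_append (c : HolDiscChain G z w) {k : ℕ} (hk : k ≤ c.m) {g : ℂ → E}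
    (hg : DifferentiableOn ℂ g (ball 0 1)) (hgG : MapsTo g (ball 0 1) G) {a b : ℂ}
    (ha : a ∈ ball (0 : ℂ) 1) (hb : b ∈ ball (0 : ℂ) 1) (hga : g a = c.x k) :
    ∃ c' : HolDiscChain G z (g b),
      c'.length = ∑ i ∈ Finset.range k, poincareDist (c.a i) (c.b i) + poincareDist a b := by
  have hcases : ∀ i < k + 1, i = k ∨ i < k ∧ i < c.m ∧ i ≠ k := fun i hi => by omega
  refine ⟨{ m := k + 1
            m_pos := k.succ_pos
            x := Function.update c.x (k + 1) (g b)
            f := Function.update c.f k g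
            a := Function.update c.a k a
            b := Function.update c.b k b
            x_zero := ?_
            x_last := by simp
            holo := ?_
            mapsTo := ?_
            a_mem := ?_
            b_mem := ?_
            f_a := ?_
            f_b := ?_ }, ?_⟩
  · rw [Function.update_of_ne (by omega), c.x_zero]
  · intro i hi
    rcases hcases i hi with rfl | ⟨_, h, hne⟩
    · simpa using hg
    · simpa [hne] using c.holo i h
  · intro i hi
    rcases hcases i hi with rfl | ⟨_, h, hne⟩
    · simpa using hgG
    · simpa [hne] using c.mapsTo i h
  · intro i hi
    rcases hcases i hi with rfl | ⟨_, h, hne⟩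
    · simpa using ha
    · simpa [hne] using c.a_mem i h
  · intro i hi
    rcases hcases i hi with rfl | ⟨_, h, hne⟩
    · simpa using hb
    · simpa [hne] using c.b_mem i h
  · intro i hi
    rw [Function.update_of_ne (f := c.x) (show i ≠ k + 1 by omega)]
    rcases hcases i hi with rfl | ⟨_, h, hne⟩
    · simpa using hga
    · simpa [hne] using c.f_a i h
  · intro i hi
    rcases hcases i hi with rfl | ⟨hik, h, hne⟩
    · simp
    · simpa [hne] using c.f_b i h
  · rw [length, Finset.sum_range_succ]
    simp only [Function.update_self]
    congr 1
    refine Finset.sum_congr rfl fun i hi => ?_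
    have hne : i ≠ k := (Finset.mem_range.mp hi).ne
    rw [Function.update_of_ne hne, Function.update_of_ne hne]

theorem exists_of_disc {g : ℂ → E} (hg : DifferentiableOn ℂ g (ball 0 1))
    (hgG : MapsTo g (ball 0 1) G) {a b : ℂ} (ha : a ∈ ball (0 : ℂ) 1) (hb : b ∈ ball (0 : ℂ) 1) :
    ∃ c : HolDiscChain G (g a) (g b), c.length = poincareDist a b := by
  refine ⟨{ m := 1
            m_pos := one_pos
            x := fun i => if i = 0 then g a else g b
            f := fun _ => g
            a := fun _ => a
            b := fun _ => b
            x_zero := by simp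
            x_last := by simp
            holo := fun _ _ => hg
            mapsTo := fun _ _ => hgG
            a_mem := fun _ _ => ha
            b_mem := fun _ _ => hb
            f_a := fun i hi => by simp [Nat.lt_one_iff.mp hi]
            f_b := fun i _ => by simp }, by simp [length]⟩

/-- The image of a chain under a holomorphic map is a chain of the same length; this is the
contraction property of the Kobayashi pseudodistance. -/
theorem exists_comp (c : HolDiscChain G z w) {H : Set F} {f : E → F}
    (hf : DifferentiableOn ℂ f G) (hfG : MapsTo f G H) :
    ∃ c' : HolDiscChain H (f z) (f w), c'.length = c.length :=
  ⟨{ m := c.m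
     m_pos := c.m_pos
     x := f ∘ c.x
     f := fun i => f ∘ c.f i
     a := c.a
     b := c.b
     x_zero := congrArg f c.x_zero
     x_last := congrArg f c.x_last
     holo := fun i hi => hf.comp (c.holo i hi) (c.mapsTo i hi)
     mapsTo := fun i hi => hfG.comp (c.mapsTo i hi)
     a_mem := c.a_mem
     b_mem := c.b_mem
     f_a := fun i hi => congrArg f (c.f_a i hi)
     f_b := fun i hi => congrArg f (c.f_b i hi) }, rfl⟩

theorem sum_range_le_length (c : HolDiscChain G z w) {k : ℕ} (hk : k ≤ c.m) :
    ∑ i ∈ Finset.range k, poincareDist (c.a i) (c.b i) ≤ c.length :=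
  Finset.sum_le_sum_of_subset_of_nonneg (Finset.range_subset_range.mpr hk)
    fun _ _ _ => poincareDist_nonneg _ _

/-! ### Small Kobayashi balls are small -/

theorem exists_le_length_of_kobayashiEDist_pos (hG : IsOpen G) (hw : w ∈ G)
    (hzw : 0 < kobayashiEDist G z w) :
    ∃ δ > 0, ∀ᶠ w' in 𝓝 w, ∀ c : HolDiscChain G z w', δ ≤ c.length := by
  obtain ⟨η, -, hη, hηk⟩ := ENNReal.lt_iff_exists_real_btwn.mp hzw
  rw [ENNReal.ofReal_pos] at hη
  obtain ⟨R, hR, hRG⟩ := Metric.isOpen_iff.mp hG w hw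
  have ht : 0 < Real.tanh (η / 2) := Real.tanh_pos_of_pos (half_pos hη)
  refine ⟨η / 2, half_pos hη, ?_⟩
  filter_upwards [ball_mem_nhds w (half_pos hR),
    ball_mem_nhds w (show 0 < R / 2 * Real.tanh (η / 2) by positivity)] with w' hw' hw'' c
  by_contra! hlt
  have hsub : ball w' (R / 2) ⊆ G :=
    (ball_subset_ball' (by linarith [mem_ball.mp hw'])).trans hRG
  -- A disc of Poincaré length `η / 2` joins the end of the chain to `w`.
  obtain ⟨g, s, hg, hgG, hs, hg0, hgs, hlen⟩ := exists_disc_of_norm_lt hsub (half_pos hη)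
    (by rwa [mem_ball', dist_eq_norm] at hw'')
  obtain ⟨c', hc'⟩ := c.exists_truncate_append le_rfl hg hgG (mem_ball_self one_pos) hs
    (by rw [hg0, c.x_last])
  subst hgs
  have h1 : kobayashiEDist G z (g s) ≤ ENNReal.ofReal c'.length := iInf_le _ c'
  have h2 : c'.length ≤ η := by
    have h3 : c'.length = c.length + η / 2 := by rw [hc', hlen]; rfl
    linarith
  exact absurd (h1.trans (ENNReal.ofReal_le_ofReal h2)) (not_le.mpr hηk)

theorem exists_le_length_of_isCompact (hG : IsOpen G) {K : Set E} (hK : IsCompact K)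
    (hKG : K ⊆ G) (hpos : ∀ w ∈ K, 0 < kobayashiEDist G z w) :
    ∃ δ > 0, ∀ w ∈ K, ∀ c : HolDiscChain G z w, δ ≤ c.length := by
  refine hK.induction_on (p := fun S => ∃ δ > 0, ∀ w ∈ S, ∀ c : HolDiscChain G z w, δ ≤ c.length)
    ⟨1, one_pos, by simp⟩ ?_ ?_ ?_
  · rintro s t hst ⟨δ, hδ, h⟩
    exact ⟨δ, hδ, fun w hw => h w (hst hw)⟩
  · rintro s t ⟨δ, hδ, h⟩ ⟨δ', hδ', h'⟩
    refine ⟨min δ δ', lt_min hδ hδ', ?_⟩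
    rintro w (hw | hw) c
    · exact (min_le_left _ _).trans (h w hw c)
    · exact (min_le_right _ _).trans (h' w hw c)
  · intro w hw
    obtain ⟨δ, hδ, h⟩ := exists_le_length_of_kobayashiEDist_pos hG (hKG hw) (hpos w hw)
    exact ⟨_, mem_nhdsWithin_of_mem_nhds h, δ, hδ, fun w' hw' => hw'⟩

/-- A chain too short to reach the sphere around its starting point cannot leave the ball: the
first disc that does so meets the sphere within the Poincaré disc centred at its starting
parameter and bounded by its end parameter, and cutting the chain there gives a shorter chain
ending on the sphere. -/
theorem mem_ball_of_length_lt {ε δ : ℝ} (hε : 0 < ε)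
    (hδ : ∀ w' ∈ sphere z ε, ∀ c : HolDiscChain G z w', δ ≤ c.length)
    (c : HolDiscChain G z w) (hc : c.length < δ) : w ∈ ball z ε := by
  suffices h : ∀ i ≤ c.m, c.x i ∈ ball z ε from c.x_last ▸ h c.m le_rfl
  intro i
  induction i with
  | zero => intro _; rw [c.x_zero]; exact mem_ball_self hε
  | succ i ih =>
    intro hi
    have him : i < c.m := hi
    have hx := ih him.le
    by_contra hout
    obtain ⟨D, hD, hDc, haD, hbD, hDle⟩ := exists_isPreconnected_poincareDist_le
      (mem_ball_zero_iff.mp (c.a_mem i him)) (mem_ball_zero_iff.mp (c.b_mem i him))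
    have hcont : ContinuousOn (fun ζ => dist (c.f i ζ) z) D :=
      
      (continuous_id.dist (continuous_const (y := z))).comp_continuousOn
        ((c.holo i him).continuousOn.mono hD)
    obtain ⟨ζ, hζD, hζ⟩ : ε ∈ (fun ζ => dist (c.f i ζ) z) '' D := by
      refine hDc.intermediate_value haD hbD hcont ⟨?_, ?_⟩
      · rw [c.f_a i him]; exact (mem_ball.mp hx).le
      · rw [c.f_b i him]; exact not_lt.mp hout
    obtain ⟨c', hc'⟩ := c.exists_truncate_append him.le (c.holo i him) (c.mapsTo i him)
      (c.a_mem i him) (hD hζD) (c.f_a i him)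
    have h1 := hδ _ (mem_sphere.mpr hζ) c'
    have h2 := c.sum_range_le_length hi
    rw [Finset.sum_range_succ] at h2
    linarith [hDle ζ hζD]

end HolDiscChain

/-- Near a fixed point, the iterates of a holomorphic self-map of a hyperbolic open set are
uniformly bounded: they contract the Kobayashi pseudodistance, and small Kobayashi balls are
bounded. -/
theorem IsKobayashiHyperbolic.exists_mapsTo_ball_iterate [ProperSpace E] {G : Set E}
    (hG : IsKobayashiHyperbolic G) (hGo : IsOpen G) {p : E} (hp : p ∈ G) {f : E → E}
    (hf : DifferentiableOn ℂ f G) (hfG : MapsTo f G G) (hfp : f p = p) :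
    ∃ r > 0, ∃ ε > 0, ball p r ⊆ G ∧ ∀ j : ℕ, MapsTo f^[j] (ball p r) (ball p ε) := by
  obtain ⟨ε, hε, hεG⟩ := nhds_basis_closedBall.mem_iff.mp (hGo.mem_nhds hp)
  have hsG : sphere p ε ⊆ G := sphere_subset_closedBall.trans hεG
  obtain ⟨δ, hδ, hlen⟩ := HolDiscChain.exists_le_length_of_isCompact (z := p) hGo
    (isCompact_sphere p ε) hsG
    fun w hw => hG p hp w (hsG hw) (ne_of_mem_sphere hw hε.ne').symm
  have ht : 0 < Real.tanh (δ / 2) := Real.tanh_pos_of_pos (half_pos hδ)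
  have hball : ball p ε ⊆ G := ball_subset_closedBall.trans hεG
  refine ⟨ε * Real.tanh (δ / 2), by positivity, ε, hε, ?_, fun j y hy => ?_⟩
  · exact (ball_subset_ball (by nlinarith [Real.tanh_lt_one (δ / 2)])).trans hball
  · obtain ⟨g, s, hg, hgG, hs, hg0, hgs, hglen⟩ := exists_disc_of_norm_lt hball (half_pos hδ)
      (by rwa [mem_ball, dist_eq_norm] at hy)
    obtain ⟨c, hc⟩ := HolDiscChain.exists_of_disc hg hgG (mem_ball_self one_pos) hs
    obtain ⟨c', hc'⟩ := c.exists_comp (hf.iterate hfG j) (hfG.iterate j)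
    have hfix : f^[j] (g 0) = p := by rw [hg0, Function.iterate_fixed hfp]
    have h := HolDiscChain.mem_ball_of_length_lt hε (by rwa [hfix]) c' (by
      rw [hc', hc, hglen]; linarith)
    rwa [hfix, hgs] at h

/-! ### Consequences of the Schwarz lemma -/

/-- A bounded holomorphic function on a ball that vanishes to infinite order at the centre is
zero. -/
theorem eqOn_zero_ball_of_forall_isLittleO {h : E → F} {c : E} {r M : ℝ}
    (hd : DifferentiableOn ℂ h (ball c r)) (hM : ∀ y ∈ ball c r, ‖h y‖ ≤ M) (hc : h c = 0)
    (ho : ∀ n : ℕ, h =o[𝓝 c] fun y => ‖y - c‖ ^ n) : EqOn h 0 (ball c r) := by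
  intro y hy
  have hr : 0 < r := nonempty_ball.mp ⟨y, hy⟩
  have hle : ∀ n : ℕ, ‖h y‖ ≤ M * (dist y c / r) ^ (n + 1) := fun n => by
    have := Complex.dist_le_mul_div_pow_of_mapsTo_ball_of_isLittleO (n := n) hd
      (R₂ := M) (fun y hy => by simpa [hc] using hM y hy) (by simpa [hc] using ho n) hy
    simpa [hc] using this
  have hlim : Tendsto (fun n : ℕ => M * (dist y c / r) ^ (n + 1)) atTop (𝓝 (M * 0)) :=
    ((tendsto_add_atTop_iff_nat 1).mpr (tendsto_pow_atTop_nhds_zero_of_lt_one (by positivity)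
      ((div_lt_one hr).mpr hy))).const_mul M
  rw [mul_zero] at hlim
  exact norm_le_zero_iff.mp (ge_of_tendsto' hlim hle)

/-- For functions holomorphic near `p`, differentiability at `p` is strict: if the remainder is
at most `η * ‖y - p‖` on a ball of radius `2 * s`, the Schwarz lemma on balls of radius `s`
bounds its increments. -/
theorem HasFDerivAt.hasStrictFDerivAt_of_eventually_differentiableAt {f : E → F} {f' : E →L[ℂ] F}
    {p : E} (hf : HasFDerivAt f f' p) (hd : ∀ᶠ y in 𝓝 p, DifferentiableAt ℂ f y) :
    HasStrictFDerivAt f f' p := by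
  refine .of_isLittleO (Asymptotics.isLittleO_iff.mpr fun {η} hη => ?_)
  set h : E → F := fun y => f y - f p - f' (y - p) with hh
  have hη' : 0 < η / 4 := by positivity
  obtain ⟨R, hR, hRb⟩ := Metric.eventually_nhds_iff_ball.mp
    (hd.and (Asymptotics.isLittleO_iff.mp hf.isLittleO hη'))
  have hs : 0 < R / 2 := half_pos hR
  have hhd : DifferentiableOn ℂ h (ball p R) := fun y hy =>
    (((hRb y hy).1.sub_const _).sub
      (f'.differentiableAt.comp y (differentiableAt_id.sub_const p))).differentiableWithinAt
  have hhb : ∀ y ∈ ball p R, ‖h y‖ ≤ η / 4 * R := fun y hy =>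
    (hRb y hy).2.trans (by gcongr; rw [← dist_eq_norm]; exact (mem_ball.mp hy).le)
  have hnear : ∀ᶠ q : E × E in 𝓝 (p, p), q.2 ∈ ball p (R / 2) ∧ dist q.1 q.2 < R / 2 := by
    refine ((continuous_snd.tendsto (p, p)).eventually (ball_mem_nhds p hs)).and
      ((continuous_fst.dist continuous_snd).tendsto (p, p) |>.eventually_lt_const ?_)
    simpa using hs
  filter_upwards [hnear] with q ⟨hq2, hq⟩
  have hsub : ball q.2 (R / 2) ⊆ ball p R := ball_subset_ball' (by linarith [mem_ball.mp hq2])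
  have hmaps : MapsTo h (ball q.2 (R / 2)) (closedBall (h q.2) (η / 2 * R)) := fun y hy => by
    rw [mem_closedBall, dist_eq_norm]
    linarith [norm_sub_le (h y) (h q.2), hhb y (hsub hy), hhb q.2 (hsub (mem_ball_self hs))]
  have key := Complex.dist_le_div_mul_dist_of_mapsTo_ball (hhd.mono hsub) hmaps (mem_ball.mpr hq)
  have e1 : η / 2 * R / (R / 2) = η := by field_simp
  have e2 : f q.1 - f q.2 - f' (q.1 - q.2) = h q.1 - h q.2 := by
    simp only [hh, map_sub]; abel
  rwa [e1, dist_eq_norm, dist_eq_norm, ← e2] at key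

theorem eqOn_zero_of_isPreconnected_of_eventuallyEq_zero {h : E → F} {G : Set E} {p : E}
    (hd : DifferentiableOn ℂ h G) (hGo : IsOpen G) (hGc : IsPreconnected G) (hp : p ∈ G)
    (h0 : h =ᶠ[𝓝 p] 0) : EqOn h 0 G := by
  suffices hsub : G ⊆ {y | h =ᶠ[𝓝 y] 0} from fun y hy => (hsub hy).self_of_nhds
  refine hGc.subset_of_closure_inter_subset isOpen_setOfPred_eventually_nhds ⟨p, hp, h0⟩ ?_
  rintro z ⟨hzcl, hzG⟩
  have hbdd : ∀ᶠ y in 𝓝 z, ‖h y‖ < ‖h z‖ + 1 :=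
    (hd.continuousOn.continuousAt (hGo.mem_nhds hzG)).norm.eventually_lt_const (lt_add_one _)
  obtain ⟨R, hR, hRb⟩ := Metric.eventually_nhds_iff_ball.mp (hbdd.and (hGo.mem_nhds hzG))
  obtain ⟨y, hy, hzy⟩ := Metric.mem_closure_iff.mp hzcl (R / 2) (half_pos hR)
  have hsub : ball y (R / 2) ⊆ ball z R := ball_subset_ball' (by rw [dist_comm]; linarith)
  have hz : EqOn h 0 (ball y (R / 2)) :=
    eqOn_zero_ball_of_forall_isLittleO (hd.mono fun u hu => (hRb u (hsub hu)).2)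
      (fun u hu => (hRb u (hsub hu)).1.le) hy.self_of_nhds
      fun n => (Asymptotics.isLittleO_zero _ _).congr' (EventuallyEq.symm hy) EventuallyEq.rfl
  exact hz.eventuallyEq_of_mem (isOpen_ball.mem_nhds hzy)

/-! ### Iterates of a map tangent to the identity -/

/-- If `f` is tangent to the identity at `p`, then `f^[j] - id` equals `j • (f - id)` to leading
order. -/
theorem HasStrictFDerivAt.iterate_sub_id_sub_isLittleO {f : E → E} {p : E}
    (hf : HasStrictFDerivAt f (ContinuousLinearMap.id ℂ E) p) (hfp : f p = p) (j : ℕ) :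
    (fun y => (f^[j] y - y) - (j : ℂ) • (f y - y)) =o[𝓝 p] fun y => f y - y := by
  induction j with
  | zero => simp
  | succ j ih =>
    have hO : (fun y => f^[j] y - y) =O[𝓝 p] fun y => f y - y := by
      simpa using ih.isBigO.add ((Asymptotics.isBigO_refl (fun y => f y - y) (𝓝 p)).const_smul_left
        (j : ℂ))
    have hcont : Tendsto f^[j] (𝓝 p) (𝓝 p) := by
      have := hf.hasFDerivAt.continuousAt.iterate hfp j
      rwa [ContinuousAt, Function.iterate_fixed hfp] at this
    have hstep : (fun y => f (f^[j] y) - f y - (f^[j] y - y)) =o[𝓝 p] fun y => f^[j] y - y :=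
      hf.isLittleO.comp_tendsto (hcont.prodMk_nhds tendsto_id)
    refine (ih.add (hstep.trans_isBigO hO)).congr_left fun y => ?_
    rw [Function.iterate_succ_apply']
    push_cast
    module

/-- If the iterates of `f` are bounded on a ball around a fixed point at which `f` is tangent to
the identity, then `f` is the identity on that ball. -/
theorem eqOn_id_of_forall_iterate_bounded {f : E → E} {p : E} {r ε : ℝ}
    (hr : 0 < r) (hd : ∀ j : ℕ, DifferentiableOn ℂ f^[j] (ball p r))
    (hb : ∀ j : ℕ, MapsTo f^[j] (ball p r) (ball p ε)) (hfp : f p = p)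
    (hf : HasFDerivAt f (ContinuousLinearMap.id ℂ E) p) :
    EqOn (fun y => f y - y) 0 (ball p r) := by
  have hstrict := hf.hasStrictFDerivAt_of_eventually_differentiableAt <| by
    filter_upwards [isOpen_ball.mem_nhds (mem_ball_self hr)] with y hy
    exact (hd 1).differentiableAt (isOpen_ball.mem_nhds hy)
  have hHd : ∀ j : ℕ, DifferentiableOn ℂ (fun y => f^[j] y - y) (ball p r) :=
    fun j => (hd j).sub differentiableOn_id
  have hfix : ∀ j : ℕ, f^[j] p - p = 0 := fun j => by rw [Function.iterate_fixed hfp, sub_self]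
  have hHb : ∀ j : ℕ, ∀ y ∈ ball p r, ‖f^[j] y - y‖ ≤ ε + r := fun j y hy => by
    rw [← dist_eq_norm]
    linarith [dist_triangle_right (f^[j] y) y p, mem_ball.mp (hb j hy), mem_ball.mp hy]
  have hε : 0 < ε + r := by linarith [nonempty_ball.mp ⟨_, hb 0 (mem_ball_self hr)⟩]
  have hsmall : ∀ n : ℕ, (fun y => f y - y) =o[𝓝 p] fun y => ‖y - p‖ ^ (n + 1) := by
    intro n
    induction n with
    | zero =>
      simpa [hfp, sub_sub_sub_cancel_right] using hf.isLittleO.norm_right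
    | succ n ih =>
      refine Asymptotics.isLittleO_iff.mpr fun η hη => ?_
      -- The constant `(ε + r) / r ^ (n + 2)` of the Schwarz lemma does not depend on `j`.
      -- Comparing with `f^[j + 1]` leaves the factor `j` in front of `‖f y - y‖`, since the error
      -- term is eventually at most `‖f y - y‖`.
      obtain ⟨j, hj⟩ := exists_nat_gt ((ε + r) / r ^ (n + 2) / η)
      have hlead := hstrict.iterate_sub_id_sub_isLittleO hfp (j + 1)
      have hHo : (fun y => f^[j + 1] y - y) =o[𝓝 p] fun y => ‖y - p‖ ^ (n + 1) := by
        simpa using (hlead.trans ih).add (ih.const_smul_left ((j + 1 : ℕ) : ℂ))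
      filter_upwards [isOpen_ball.mem_nhds (mem_ball_self hr),
        Asymptotics.isLittleO_iff.mp hlead one_pos] with y hy hle
      have hschwarz := Complex.dist_le_mul_div_pow_of_mapsTo_ball_of_isLittleO (n := n + 1)
        (hHd (j + 1)) (R₂ := ε + r)
        (fun y hy => by simpa only [hfix, mem_closedBall_zero_iff] using hHb (j + 1) y hy)
        (by simpa only [hfix, sub_zero] using hHo) hy
      simp only [hfix, dist_zero_right] at hschwarz
      have hnorm : ‖((j + 1 : ℕ) : ℂ) • (f y - y)‖ = (j + 1) * ‖f y - y‖ := by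
        rw [norm_smul, Complex.norm_natCast]; push_cast; rfl
      have htri := norm_sub_norm_le (((j + 1 : ℕ) : ℂ) • (f y - y)) (f^[j + 1] y - y)
      rw [hnorm, norm_sub_rev (((j + 1 : ℕ) : ℂ) • (f y - y))] at htri
      rw [one_mul] at hle
      have hjle : j * ‖f y - y‖ ≤ (ε + r) / r ^ (n + 2) * ‖y - p‖ ^ (n + 2) := by
        rw [dist_eq_norm, div_pow, mul_div_assoc', mul_div_right_comm] at hschwarz
        linarith
      rw [Real.norm_of_nonneg (by positivity)]
      have hjpos : (0 : ℝ) < j := lt_trans (by positivity) hj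
      rw [div_lt_iff₀ hη] at hj
      refine le_of_mul_le_mul_left (hjle.trans ?_) hjpos
      rw [← mul_assoc]
      gcongr
  refine eqOn_zero_ball_of_forall_isLittleO (hHd 1) (hHb 1) (hfix 1) fun n => ?_
  cases n with
  | zero =>
    refine (hsmall 0).trans_isBigO (Asymptotics.IsBigO.of_bound 1 ?_)
    filter_upwards [ball_mem_nhds p one_pos] with y hy
    simpa using (mem_ball_iff_norm.mp hy).le
  | succ n => exact hsmall n

/-- **Generalized Cartan uniqueness theorem.** -/
theorem mainTheorem5 (n : ℕ) (G : Set (EuclideanSpace ℂ (Fin n)))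
    (hG_open : IsOpen G) (hG_conn : IsConnected G) (hG : IsKobayashiHyperbolic G)
    (p : EuclideanSpace ℂ (Fin n)) (hp : p ∈ G)
    (f : EuclideanSpace ℂ (Fin n) → EuclideanSpace ℂ (Fin n))
    (hf : DifferentiableOn ℂ f G) (hfG : Set.MapsTo f G G)
    (hfp : f p = p)
    (hdf : HasFDerivAt f (ContinuousLinearMap.id ℂ (EuclideanSpace ℂ (Fin n))) p) :
    ∀ z ∈ G, f z = z := by
  obtain ⟨r, hr, ε, -, hrG, hb⟩ := hG.exists_mapsTo_ball_iterate hG_open hp hf hfG hfp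
  have hloc := eqOn_id_of_forall_iterate_bounded hr (fun j => (hf.iterate hfG j).mono hrG) hb
    hfp hdf
  have hglob := eqOn_zero_of_isPreconnected_of_eventuallyEq_zero (hf.sub differentiableOn_id)
    hG_open hG_conn.isPreconnected hp (hloc.eventuallyEq_of_mem (ball_mem_nhds p hr))
  exact fun z hz => sub_eq_zero.mp (hglob hz)
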